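/- Let $L=\sum_{i=0}^r a_i(n)S^i$ be a recurrence operator with coefficients $a_i\in\mathbb{Q}(n)$ having no poles at the natural numbers, where $(Su)(n)=u(n+1)$; a sequence $u$ is a solution of $L$ if $\sum_{i=0}^r a_i(n)u(n+i)=0$ for all $n\in\mathbb{N}$. Assume that $L$ satisfies the Poincaré–Perron conditions: $a_r=1$, the limits $a_i=\lim_{n\to\infty}a_i(n)$ exist in $\mathbb{R}$, and the roots $\lambda_1,\dots,\lambda_r$ of the characteristic polynomial $\sum_{i=0}^r a_it^i$ are nonzero with $|\lambda_1|>|\lambda_2|>\dots>|\lambda_r|$. Call functions $f_1,\dots,f_r:\mathbb{N}\to\mathbb{C}$ an asymptotic system for $L$ if each $\lambda_i^nf_i(n)$ is a solution of $L$ and $f_i(n+1)/f_i(n)\to1$ for each $i$. (1) If $a_0(n)\neq0$ for all $n\in\mathbb{N}$, then an asymptotic system exists; and for every asymptotic system, each solution $u$ of $L$ can be written as $u(n)=\sum_{i=1}^r c_i\lambda_i^nf_i(n)$ ($n\in\mathbb{N}$) with unique constants $c_i\in\mathbb{C}$. (2) Let $f_1,\dots,f_r$ be any asymptotic system for $L$,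 and let $u_1,u_2:\mathbb{N}\to\mathbb{R}$ be two linearly independent solutions of $L$ with expansions $$u_1(n)=\sum_{i=1}^r c_i\lambda_i^nf_i(n),\qquad u_2(n)=\sum_{i=1}^r\tilde c_i\lambda_i^nf_i(n)\qquad(n\in\mathbb{N}).$$ Then $u_1(n)/u_2(n)$ (defined for all large $n$) has a limit in $\mathbb{R}\setminus\{0\}$ if and only if $$\min\{1\le i\le r: c_i\neq0\}=\min\{1\le i\le r:\tilde c_i\neq0\}.$$ In that case, let $j$ be this common index. Then $\{1\le i\le r:\tilde c_jc_i-c_j\tilde c_i\neq0\}$ is nonempty, and with $k$ its minimum, $$\lim_{n\to\infty}\frac{u_1(n)}{u_2(n)}=\frac{c_j}{\tilde c_j},\qquad \rho:=\lim_{n\to\infty}\frac1n\log\left|\frac{u_1(n)}{u_2(n)}-\frac{c_j}{\tilde c_j}\right|=\log\left|\frac{\lambda_k}{\lambda_j}\right|,$$ where the logarithm on the left is that of a nonzero number for all large $n$. -/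

import Mathlib

open Filter Topology

/-- The value `a(n)` of a rational function `a ∈ ℚ(n)` at a natural number. -/
noncomputable def coeffAt (a : RatFunc ℚ) (n : ℕ) : ℚ :=
  RatFunc.eval (RingHom.id ℚ) (n : ℚ) a

/-- The recurrence operator `L = ∑_{i=0}^r a_i(n) S^i ∈ ℚ(n)[S]` is given by its coefficients
`a 0, …, a r`. The sequence `u`, with values in a field of characteristic zero, is a solution:
`(L.u)(n) = ∑_{i=0}^r a_i(n) u(n+i) = 0` for every `n`. -/
def IsSolution {K : Type*} [Field K] [CharZero K] {r : ℕ} (a : Fin (r + 1) → RatFunc ℚ)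
    (u : ℕ → K) : Prop :=
  ∀ n : ℕ, ∑ i : Fin (r + 1), ((coeffAt (a i) n : ℚ) : K) * u (n + (i : ℕ)) = 0

/-- The Poincaré–Perron conditions on `L = ∑_{i=0}^r a_i(n) S^i`, whose eigenvalues (the roots of
the characteristic polynomial `∑ (lim a_i(n)) t^i`, with multiplicity) are listed as `lam`. -/
structure PoincarePerron {r : ℕ} (a : Fin (r + 1) → RatFunc ℚ) (lam : Fin r → ℂ) : Prop where
  monic : a (Fin.last r) = 1
  /-- no coefficient has a pole at a natural number -/
  regular : ∀ (i : Fin (r + 1)) (n : ℕ), (a i).denom.eval (n : ℚ) ≠ 0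
  charpoly : ∃ α : Fin (r + 1) → ℝ,
    (∀ i, Tendsto (fun n : ℕ => ((coeffAt (a i) n : ℚ) : ℝ)) atTop (𝓝 (α i))) ∧
    ∑ i : Fin (r + 1), Polynomial.C (α i : ℂ) * Polynomial.X ^ (i : ℕ)
      = ∏ i : Fin r, (Polynomial.X - Polynomial.C (lam i))
  /-- `|λ_1| > |λ_2| > ⋯ > |λ_r|` -/
  strictAnti : StrictAnti fun i => ‖lam i‖
  ne_zero : ∀ i, lam i ≠ 0

/-- The functions `f_i` of the asymptotic decomposition: each `λ_i^n f_i(n)` solves the recurrence,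
and `f_i(n+1)/f_i(n) → 1`. -/
structure IsAsymptoticSystem {r : ℕ} (a : Fin (r + 1) → RatFunc ℚ) (lam : Fin r → ℂ)
    (f : Fin r → ℕ → ℂ) : Prop where
  solution : ∀ i, IsSolution a fun n => lam i ^ n * f i n
  ratio : ∀ i, Tendsto (fun n => f i (n + 1) / f i n) atTop (𝓝 1)

/-- `c` are multiplicative constants of `u`: `u(n) = ∑ c_i λ_i^n f_i(n)` for every `n`. -/
def IsExpansion {r : ℕ} (lam : Fin r → ℂ) (f : Fin r → ℕ → ℂ) (c : Fin r → ℂ)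
    (u : ℕ → ℂ) : Prop :=
  ∀ n : ℕ, u n = ∑ i : Fin r, c i * lam i ^ n * f i n

/-- The ratio `u₁(n)/u₂(n)` is defined for all large `n` and converges to `l`. -/
def HasAperyLimit (u₁ u₂ : ℕ → ℝ) (l : ℝ) : Prop :=
  (∀ᶠ n in atTop, u₂ n ≠ 0) ∧ Tendsto (fun n => u₁ n / u₂ n) atTop (𝓝 l)

/-- The sequence `s` converges to `l` with convergence rate `ρ = lim log|s_n - l| / n`;
the logarithm is required to make sense for all large `n`. -/
def HasConvergenceRate (s : ℕ → ℝ) (l ρ : ℝ) : Prop :=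
  Tendsto s atTop (𝓝 l) ∧ (∀ᶠ n in atTop, s n ≠ l) ∧
    Tendsto (fun n : ℕ => Real.log |s n - l| / n) atTop (𝓝 ρ)

/-! ### Sequences whose successive quotients converge -/

/-! Put `g i n = lam i ^ n * f i n`, so that `g i (n + 1) / g i n` tends to `lam i`. As the moduli
are distinct, `g i / g j → 0` for `j < i`, so a combination is governed by its first nonzero
coefficient (`tendsto_combination_div`, `tendsto_combination_ratio`). This decides when `u₁ / u₂`
has a nonzero limit. The error `u₁ / u₂ - c j / c' j` is, up to a constant, a quotient of two
combinations with leading indices `k` and `j`; its successive quotients tend to `lam k / lam j`, and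
averaging their logarithms gives the rate. The same domination makes the `g i` linearly independent,
hence a basis of the `r`-dimensional solution space.

Existence of an asymptotic system is Perron's theorem. In the eigenbasis of the limiting companion
matrix the recurrence becomes a diagonal recursion with relative perturbation tending to `0`. For
each `i`, a dimension count and compactness produce a trajectory on which the coordinates before `i`
never dominate, while those up to `i` always do (`exists_trajectory_in_cones`). Contraction of the
block ratios then concentrates it at coordinate `i` (`tendsto_div_zero_of_cones`), and the
corresponding solution has successive quotients tending to `lam i`. -/

theorem tendsto_zero_of_tendsto_ratio {h : ℕ → ℂ} {μ : ℂ} (hne : ∀ᶠ n in atTop, h n ≠ 0)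
    (hμ : ‖μ‖ < 1) (hr : Tendsto (fun n => h (n + 1) / h n) atTop (𝓝 μ)) :
    Tendsto h atTop (𝓝 0) := by
  refine (summable_of_ratio_test_tendsto_lt_one hμ hne ?_).tendsto_atTop_zero
  simpa using hr.norm

theorem eventually_ne_zero_of_tendsto_ratio {h : ℕ → ℂ} {μ : ℂ} (hμ : μ ≠ 0)
    (hr : Tendsto (fun n => h (n + 1) / h n) atTop (𝓝 μ)) : ∀ᶠ n in atTop, h n ≠ 0 := by
  -- Where `h n = 0` the quotient is `0` by the convention for division by zero, which a limit `μ ≠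
  -- 0` excludes eventually.
  filter_upwards [hr.eventually_ne hμ] with n hn h0
  simp [h0] at hn

theorem tendsto_log_norm_div_of_tendsto_ratio {h : ℕ → ℂ} {μ : ℂ} (hμ : μ ≠ 0)
    (hr : Tendsto (fun n => h (n + 1) / h n) atTop (𝓝 μ)) :
    Tendsto (fun n : ℕ => Real.log ‖h n‖ / n) atTop (𝓝 (Real.log ‖μ‖)) := by
  have hne := eventually_ne_zero_of_tendsto_ratio hμ hr
  have h1 : Tendsto (fun n => Real.log ‖h (n + 1)‖ - Real.log ‖h n‖) atTop
      (𝓝 (Real.log ‖μ‖)) := by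
    refine (hr.norm.log (norm_ne_zero_iff.2 hμ)).congr' ?_
    filter_upwards [hne, (tendsto_add_atTop_nat 1).eventually hne] with n hn hn1
    rw [norm_div, Real.log_div (norm_ne_zero_iff.2 hn1) (norm_ne_zero_iff.2 hn)]
  -- The Cesàro means telescope to `(log ‖h n‖ - log ‖h 0‖) / n`; the constant term is then added
  -- back.
  have h2 := h1.cesaro
  simp_rw [Finset.sum_range_sub (fun n => Real.log ‖h n‖)] at h2
  have h3 := h2.add (tendsto_natCast_atTop_atTop (R := ℝ) |>.const_div_atTop (Real.log ‖h 0‖))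
  rw [add_zero] at h3
  refine h3.congr fun n => ?_
  ring

/-! ### Combinations of sequences of distinct growth -/

section Combination

variable {r : ℕ} {lam : Fin r → ℂ} {g : Fin r → ℕ → ℂ}

theorem tendsto_div_zero_of_norm_lt {g h : ℕ → ℂ} {μ ν : ℂ} (hμ : μ ≠ 0) (hν : ν ≠ 0)
    (hlt : ‖ν‖ < ‖μ‖) (hg : Tendsto (fun n => g (n + 1) / g n) atTop (𝓝 μ))
    (hh : Tendsto (fun n => h (n + 1) / h n) atTop (𝓝 ν)) :
    Tendsto (fun n => h n / g n) atTop (𝓝 0) := by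
  refine tendsto_zero_of_tendsto_ratio (μ := ν / μ) ?_ ?_ ?_
  · filter_upwards [eventually_ne_zero_of_tendsto_ratio hμ hg,
      eventually_ne_zero_of_tendsto_ratio hν hh] with n h1 h2 using div_ne_zero h2 h1
  · rw [norm_div]
    exact (div_lt_one (norm_pos_iff.2 hμ)).2 hlt
  · refine (hh.div hg hμ).congr fun n => ?_
    exact div_div_div_comm _ _ _ _

theorem tendsto_combination_div (hanti : StrictAnti fun i => ‖lam i‖) (h0 : ∀ i, lam i ≠ 0)
    (hg : ∀ i, Tendsto (fun n => g i (n + 1) / g i n) atTop (𝓝 (lam i))) (c : Fin r → ℂ)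
    {j : Fin r} (hj : ∀ i < j, c i = 0) :
    Tendsto (fun n => (∑ i, c i * g i n) / g j n) atTop (𝓝 (c j)) := by
  have h1 : ∀ i, Tendsto (fun n => c i * (g i n / g j n)) atTop (𝓝 (if i = j then c j else 0)) := by
    intro i
    rcases lt_trichotomy i j with h | h | h
    · simp [hj i h, h.ne]
    · subst h
      simp only [if_true]
      refine tendsto_const_nhds.congr' ?_
      filter_upwards [eventually_ne_zero_of_tendsto_ratio (h0 i) (hg i)] with n hn
      rw [div_self hn, mul_one]
    · simpa [h.ne'] using
        (tendsto_div_zero_of_norm_lt (h0 j) (h0 i) (hanti h) (hg j) (hg i)).const_mul (c i)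
  have h2 := tendsto_finsetSum Finset.univ fun i _ => h1 i
  rw [Finset.sum_ite_eq' Finset.univ j] at h2
  simp only [Finset.mem_univ, if_true] at h2
  refine h2.congr fun n => ?_
  rw [Finset.sum_div]
  exact Finset.sum_congr rfl fun i _ => (mul_div_assoc _ _ _).symm

theorem tendsto_combination_ratio (hanti : StrictAnti fun i => ‖lam i‖) (h0 : ∀ i, lam i ≠ 0)
    (hg : ∀ i, Tendsto (fun n => g i (n + 1) / g i n) atTop (𝓝 (lam i))) (c : Fin r → ℂ)
    {j : Fin r} (hj : IsLeast {i | c i ≠ 0} j) :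
    Tendsto (fun n => (∑ i, c i * g i (n + 1)) / ∑ i, c i * g i n) atTop (𝓝 (lam j)) := by
  have hlow : ∀ i < j, c i = 0 := fun i hi => by
    by_contra h
    exact absurd (hj.2 h) (not_le.2 hi)
  have h1 := tendsto_combination_div hanti h0 hg c hlow
  have h2 := ((h1.comp (tendsto_add_atTop_nat 1)).div h1 hj.1).mul (hg j)
  rw [div_self hj.1, one_mul] at h2
  have hne := eventually_ne_zero_of_tendsto_ratio (h0 j) (hg j)
  refine h2.congr' ?_
  filter_upwards [hne, (tendsto_add_atTop_nat 1).eventually hne, h1.eventually_ne hj.1]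
    with n ha hb hc
  have hd : (∑ i, c i * g i n) ≠ 0 := fun h => hc (by simp [h])
  simp only [Function.comp, Pi.div_apply]
  field_simp

theorem exists_isLeast_ne_zero {c : Fin r → ℂ} (hc : c ≠ 0) : ∃ j, IsLeast {i | c i ≠ 0} j := by
  obtain ⟨i, hi⟩ := Function.ne_iff.1 hc
  exact ⟨_, WellFounded.min_mem wellFounded_lt {i | c i ≠ 0} ⟨i, hi⟩,
    fun k hk => WellFounded.min_le wellFounded_lt hk⟩

theorem eq_zero_of_combination_eq_zero (hanti : StrictAnti fun i => ‖lam i‖) (h0 : ∀ i, lam i ≠ 0)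
    (hg : ∀ i, Tendsto (fun n => g i (n + 1) / g i n) atTop (𝓝 (lam i))) (c : Fin r → ℂ)
    (hc : ∀ n, ∑ i, c i * g i n = 0) : c = 0 := by
  by_contra h
  obtain ⟨j, hj⟩ := exists_isLeast_ne_zero h
  have h1 := tendsto_combination_ratio hanti h0 hg c hj
  -- All successive quotients are `0 / 0 = 0`, yet they should tend to `lam j ≠ 0`.
  simp only [hc, div_zero] at h1
  exact h0 j (tendsto_nhds_unique h1 tendsto_const_nhds)

end Combination

/-! ### Quotients of two real solutions -/

section Quotient

variable {r : ℕ} {lam : Fin r → ℂ} {g : Fin r → ℕ → ℂ} {u₁ u₂ : ℕ → ℝ} {c c' : Fin r → ℂ}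

theorem hasAperyLimit_of_isLeast (hanti : StrictAnti fun i => ‖lam i‖) (h0 : ∀ i, lam i ≠ 0)
    (hg : ∀ i, Tendsto (fun n => g i (n + 1) / g i n) atTop (𝓝 (lam i)))
    (h₁ : ∀ n, (u₁ n : ℂ) = ∑ i, c i * g i n) (h₂ : ∀ n, (u₂ n : ℂ) = ∑ i, c' i * g i n)
    {j : Fin r} (hj : IsLeast {i | c i ≠ 0} j) (hj' : IsLeast {i | c' i ≠ 0} j) :
    ∃ l : ℝ, (l : ℂ) = c j / c' j ∧ HasAperyLimit u₁ u₂ l := by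
  have low : ∀ {d : Fin r → ℂ}, IsLeast {i | d i ≠ 0} j → ∀ i < j, d i = 0 := fun hd i hi => by
    by_contra h
    exact absurd (hd.2 h) (not_le.2 hi)
  have t₁ := tendsto_combination_div hanti h0 hg c (low hj)
  have t₂ := tendsto_combination_div hanti h0 hg c' (low hj')
  have hgj := eventually_ne_zero_of_tendsto_ratio (h0 j) (hg j)
  have hlim : Tendsto (fun n => ((u₁ n / u₂ n : ℝ) : ℂ)) atTop (𝓝 (c j / c' j)) := by
    refine (t₁.div t₂ hj'.1).congr' ?_
    filter_upwards [hgj] with n hn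
    simp only [Pi.div_apply, ← h₁, ← h₂, Complex.ofReal_div]
    exact div_div_div_cancel_right₀ hn _ _
  -- The constants are complex, but their quotient is a limit of real numbers.
  have hre : ((c j / c' j).re : ℂ) = c j / c' j := by
    have him : Tendsto (fun n => ((u₁ n / u₂ n : ℝ) : ℂ).im) atTop (𝓝 (c j / c' j).im) :=
      (Complex.continuous_im.tendsto _).comp hlim
    simp only [Complex.ofReal_im] at him
    have := tendsto_nhds_unique him tendsto_const_nhds
    exact Complex.ext (by simp) (by simp [this])
  refine ⟨(c j / c' j).re, hre, ?_, ?_⟩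
  · filter_upwards [t₂.eventually_ne hj'.1] with n hn h
    simp [← h₂, h] at hn
  · exact (Complex.continuous_re.tendsto _).comp hlim

theorem tendsto_div_zero_of_isLeast_lt (hanti : StrictAnti fun i => ‖lam i‖)
    (h0 : ∀ i, lam i ≠ 0)
    (hg : ∀ i, Tendsto (fun n => g i (n + 1) / g i n) atTop (𝓝 (lam i)))
    (h₁ : ∀ n, (u₁ n : ℂ) = ∑ i, c i * g i n) (h₂ : ∀ n, (u₂ n : ℂ) = ∑ i, c' i * g i n)
    {j j' : Fin r} (hj : IsLeast {i | c i ≠ 0} j) (hj' : IsLeast {i | c' i ≠ 0} j')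
    (hlt : j' < j) : Tendsto (fun n => u₁ n / u₂ n) atTop (𝓝 0) := by
  have h := tendsto_div_zero_of_norm_lt (g := fun n => ∑ i, c' i * g i n)
    (h := fun n => ∑ i, c i * g i n) (h0 j') (h0 j) (hanti hlt)
    (tendsto_combination_ratio hanti h0 hg c' hj') (tendsto_combination_ratio hanti h0 hg c hj)
  simp only [← h₁, ← h₂, ← Complex.ofReal_div] at h
  exact (Complex.continuous_re.tendsto _).comp h

theorem exists_isLeast_of_hasAperyLimit (hanti : StrictAnti fun i => ‖lam i‖)
    (h0 : ∀ i, lam i ≠ 0)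
    (hg : ∀ i, Tendsto (fun n => g i (n + 1) / g i n) atTop (𝓝 (lam i)))
    (h₁ : ∀ n, (u₁ n : ℂ) = ∑ i, c i * g i n) (h₂ : ∀ n, (u₂ n : ℂ) = ∑ i, c' i * g i n)
    (hc : c ≠ 0) (hc' : c' ≠ 0) {l : ℝ} (hl0 : l ≠ 0) (hl : HasAperyLimit u₁ u₂ l) :
    ∃ j, IsLeast {i | c i ≠ 0} j ∧ IsLeast {i | c' i ≠ 0} j := by
  obtain ⟨j, hj⟩ := exists_isLeast_ne_zero hc
  obtain ⟨j', hj'⟩ := exists_isLeast_ne_zero hc'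
  rcases lt_trichotomy j j' with h | h | h
  · have h1 := tendsto_div_zero_of_isLeast_lt hanti h0 hg h₂ h₁ hj' hj h
    have h2 := hl.2.inv₀ hl0
    simp only [inv_div] at h2
    exact absurd (tendsto_nhds_unique h2 h1) (inv_ne_zero hl0)
  · exact ⟨j, hj, h ▸ hj'⟩
  · exact absurd (tendsto_nhds_unique hl.2
      (tendsto_div_zero_of_isLeast_lt hanti h0 hg h₁ h₂ hj hj' h)) hl0

/-- Clearing denominators in `u₁ / u₂ - c j / c' j` leaves the numerator `c' j * u₁ - c j * u₂`, a
combination whose leading index is `k`. Its coefficients vanish up to index `j`, so `j < k`. -/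
theorem hasConvergenceRate_of_isLeast (hanti : StrictAnti fun i => ‖lam i‖) (h0 : ∀ i, lam i ≠ 0)
    (hg : ∀ i, Tendsto (fun n => g i (n + 1) / g i n) atTop (𝓝 (lam i)))
    (h₁ : ∀ n, (u₁ n : ℂ) = ∑ i, c i * g i n) (h₂ : ∀ n, (u₂ n : ℂ) = ∑ i, c' i * g i n)
    {j k : Fin r} (hj' : IsLeast {i | c' i ≠ 0} j)
    (hk : IsLeast {i | c' j * c i - c j * c' i ≠ 0} k) {l : ℝ} (hl : (l : ℂ) = c j / c' j)
    (hlim : HasAperyLimit u₁ u₂ l) :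
    HasConvergenceRate (fun n => u₁ n / u₂ n) l (Real.log ‖lam k / lam j‖) := by
  have hcj : c' j ≠ 0 := hj'.1
  have hkj : lam k / lam j ≠ 0 := div_ne_zero (h0 k) (h0 j)
  have hdiff : ∀ᶠ n in atTop, ((u₁ n / u₂ n - l : ℝ) : ℂ) =
      (c' j)⁻¹ * ((∑ i, (c' j * c i - c j * c' i) * g i n) / ∑ i, c' i * g i n) := by
    filter_upwards [hlim.1] with n hn
    have hn' : (u₂ n : ℂ) ≠ 0 := by exact_mod_cast hn
    have hsum : ∑ i, (c' j * c i - c j * c' i) * g i n = c' j * u₁ n - c j * u₂ n := by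
      rw [h₁, h₂, Finset.mul_sum, Finset.mul_sum, ← Finset.sum_sub_distrib]
      exact Finset.sum_congr rfl fun i _ => by ring
    rw [hsum, ← h₂, Complex.ofReal_sub, Complex.ofReal_div, hl]
    field_simp
  have hratio : Tendsto (fun n => ((u₁ (n + 1) / u₂ (n + 1) - l : ℝ) : ℂ) /
      ((u₁ n / u₂ n - l : ℝ) : ℂ)) atTop (𝓝 (lam k / lam j)) := by
    refine ((tendsto_combination_ratio hanti h0 hg _ hk).div
      (tendsto_combination_ratio hanti h0 hg c' hj') (h0 j)).congr' ?_
    filter_upwards [hdiff, (tendsto_add_atTop_nat 1).eventually hdiff] with n hn hn1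
    rw [hn, hn1, mul_div_mul_left _ _ (inv_ne_zero hcj)]
    exact div_div_div_comm _ _ _ _
  refine ⟨hlim.2, ?_, ?_⟩
  · filter_upwards [eventually_ne_zero_of_tendsto_ratio
      (h := fun n => ((u₁ n / u₂ n - l : ℝ) : ℂ)) hkj hratio] with n hn h
    exact hn (by simp [h])
  · simpa only [Complex.norm_real, Real.norm_eq_abs] using tendsto_log_norm_div_of_tendsto_ratio
      (h := fun n => ((u₁ n / u₂ n - l : ℝ) : ℂ)) hkj hratio

end Quotient

/-! ### Perturbed diagonal recursions -/

section Dynamics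

variable {r : ℕ}

/-- The sup norm of the coordinates of `v` that lie in `s`. -/
noncomputable def blockNorm (s : Set (Fin r)) (v : Fin r → ℂ) : ℝ := ‖s.indicator v‖

theorem blockNorm_nonneg (s : Set (Fin r)) (v : Fin r → ℂ) : 0 ≤ blockNorm s v := norm_nonneg _

theorem blockNorm_le_iff {s : Set (Fin r)} {v : Fin r → ℂ} {x : ℝ} (hx : 0 ≤ x) :
    blockNorm s v ≤ x ↔ ∀ k ∈ s, ‖v k‖ ≤ x := by
  rw [blockNorm, pi_norm_le_iff_of_nonneg hx]
  refine ⟨fun h k hk => by simpa [hk] using h k, fun h k => ?_⟩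
  by_cases hk : k ∈ s
  · simpa [hk] using h k hk
  · simpa [hk] using hx

theorem norm_le_blockNorm {s : Set (Fin r)} (v : Fin r → ℂ) {k : Fin r} (hk : k ∈ s) :
    ‖v k‖ ≤ blockNorm s v :=
  (blockNorm_le_iff (blockNorm_nonneg s v)).1 le_rfl k hk

theorem blockNorm_le_norm (s : Set (Fin r)) (v : Fin r → ℂ) : blockNorm s v ≤ ‖v‖ :=
  (blockNorm_le_iff (norm_nonneg v)).2 fun k _ => norm_le_pi_norm v k

theorem norm_le_max_blockNorm (s : Set (Fin r)) (v : Fin r → ℂ) :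
    ‖v‖ ≤ max (blockNorm s v) (blockNorm sᶜ v) := by
  rw [pi_norm_le_iff_of_nonneg (le_max_of_le_left (blockNorm_nonneg s v))]
  intro k
  by_cases hk : k ∈ s
  · exact le_max_of_le_left (norm_le_blockNorm v hk)
  · exact le_max_of_le_right (norm_le_blockNorm v hk)

theorem continuous_blockNorm (s : Set (Fin r)) : Continuous (blockNorm s) := by
  refine continuous_norm.comp (continuous_pi fun k => ?_)
  by_cases hk : k ∈ s
  · simpa [hk] using continuous_apply k
  · simpa [hk] using continuous_const

/-- The moduli of `lam` on `s` are at least `a`, those outside `s` are at most `b < a`. -/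
structure Separates (lam : Fin r → ℂ) (s : Set (Fin r)) (a b : ℝ) : Prop where
  pos : 0 < b
  lt : b < a
  le_norm : ∀ k ∈ s, a ≤ ‖lam k‖
  norm_le : ∀ k ∉ s, ‖lam k‖ ≤ b

theorem exists_separates {lam : Fin r → ℂ} (hanti : StrictAnti fun i => ‖lam i‖)
    (h0 : ∀ i, lam i ≠ 0) {s : Set (Fin r)} (hs : IsLowerSet s) :
    ∃ a b, Separates lam s a b := by
  classical
  -- The element `0` forces `b` to be positive, also when `s` is everything.
  let lo : Finset ℝ := insert 0 ((Finset.univ.filter (· ∉ s)).image fun k => ‖lam k‖)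
  let hi : Finset ℝ := (Finset.univ.filter (· ∈ s)).image fun k => ‖lam k‖
  have hlohi : ∀ x ∈ lo, ∀ y ∈ hi, x < y := by
    intro x hx y hy
    obtain ⟨k, hk, rfl⟩ := Finset.mem_image.1 hy
    rcases Finset.mem_insert.1 hx with rfl | hx
    · exact norm_pos_iff.2 (h0 k)
    · obtain ⟨m, hm, rfl⟩ := Finset.mem_image.1 hx
      refine hanti (lt_of_not_ge fun hmk => ?_)
      exact (Finset.mem_filter.1 hm).2 (hs hmk (Finset.mem_filter.1 hk).2)
  obtain ⟨a, ha, ha'⟩ := Order.exists_between_finsets lo hi hlohi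
  obtain ⟨b, hb, hb'⟩ := Order.exists_between_finsets lo {a} (by simpa using ha)
  refine ⟨a, b, hb 0 (Finset.mem_insert_self _ _), hb' a (Finset.mem_singleton_self a),
    fun k hk => (ha' _ (Finset.mem_image_of_mem _ (by simpa using hk))).le,
    fun k hk => (hb _ (Finset.mem_insert_of_mem (Finset.mem_image_of_mem _ ?_))).le⟩
  simpa using hk

variable {lam : Fin r → ℂ} {s : Set (Fin r)} {a b d : ℝ} {v v' : Fin r → ℂ}

theorem Separates.mul_blockNorm_le (h : Separates lam s a b) (hd : 0 ≤ d)
    (hv : ∀ k, ‖v' k - lam k * v k‖ ≤ d) : a * blockNorm s v ≤ blockNorm s v' + d := by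
  have ha : 0 < a := h.pos.trans h.lt
  rw [← le_div_iff₀' ha, blockNorm_le_iff
    (div_nonneg (add_nonneg (blockNorm_nonneg _ _) hd) ha.le)]
  intro k hk
  rw [le_div_iff₀' ha]
  calc a * ‖v k‖ ≤ ‖lam k‖ * ‖v k‖ := by gcongr; exact h.le_norm k hk
    _ = ‖v' k - (v' k - lam k * v k)‖ := by rw [sub_sub_cancel, norm_mul]
    _ ≤ ‖v' k‖ + ‖v' k - lam k * v k‖ := norm_sub_le _ _
    _ ≤ _ := add_le_add (norm_le_blockNorm v' hk) (hv k)

theorem Separates.blockNorm_compl_le (h : Separates lam s a b) (hd : 0 ≤ d)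
    (hv : ∀ k, ‖v' k - lam k * v k‖ ≤ d) : blockNorm sᶜ v' ≤ b * blockNorm sᶜ v + d := by
  rw [blockNorm_le_iff (add_nonneg (mul_nonneg h.pos.le (blockNorm_nonneg _ _)) hd)]
  intro k hk
  calc ‖v' k‖ = ‖lam k * v k + (v' k - lam k * v k)‖ := by rw [add_sub_cancel]
    _ ≤ ‖lam k‖ * ‖v k‖ + ‖v' k - lam k * v k‖ := by
      rw [← norm_mul]
      exact norm_add_le _ _
    _ ≤ _ := by
      gcongr
      · exact h.pos.le
      · exact h.norm_le k hk
      · exact norm_le_blockNorm v hk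
      · exact hv k

/-- The cone where the coordinates in `s` dominate is invariant under small perturbations. -/
theorem Separates.cone_step (h : Separates lam s a b) (hd : 0 ≤ d) (hd' : d ≤ (a - b) / 2)
    (hv : ∀ k, ‖v' k - lam k * v k‖ ≤ d * ‖v‖) (hle : blockNorm sᶜ v ≤ blockNorm s v)
    (hpos : 0 < blockNorm s v) :
    blockNorm sᶜ v' ≤ blockNorm s v' ∧ 0 < blockNorm s v' := by
  have hnorm : ‖v‖ ≤ blockNorm s v := (norm_le_max_blockNorm s v).trans (max_le le_rfl hle)
  have hv' : ∀ k, ‖v' k - lam k * v k‖ ≤ d * blockNorm s v := fun k => (hv k).trans (by gcongr)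
  have h1 := h.mul_blockNorm_le (by positivity) hv'
  have h2 := h.blockNorm_compl_le (by positivity) hv'
  have h3 : b * blockNorm sᶜ v ≤ b * blockNorm s v := by gcongr; exact h.pos.le
  have h4 : d * blockNorm s v ≤ (a - b) / 2 * blockNorm s v := by gcongr
  -- The midpoint `(a + b) / 2` separates the blocks: `a - d` is at least this and `b + d` at most
  -- this.
  have h5 : 0 < (a + b) * blockNorm s v := mul_pos (by linarith [h.pos, h.lt]) hpos
  constructor <;> nlinarith

/-- The infimum `L` of the eventual upper bounds satisfies `L ≤ β * L`, so it is `0`. Phrasing `H`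
through eventual bounds allows the contraction to run forwards or backwards in time. -/
theorem tendsto_zero_of_contraction {w : ℕ → ℝ} {β : ℝ} (hw : ∀ n, 0 ≤ w n) (hβ : β < 1)
    (hβ0 : 0 ≤ β) {B₀ : ℝ} (hB₀ : ∀ n, w n ≤ B₀)
    (H : ∀ B, (∀ᶠ n in atTop, w n ≤ B) → ∀ η > 0, ∀ᶠ n in atTop, w n ≤ β * B + η) :
    Tendsto w atTop (𝓝 0) := by
  set S : Set ℝ := {B | ∀ᶠ n in atTop, w n ≤ B} with hS
  have hlow : ∀ B ∈ S, 0 ≤ B := fun B hB => by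
    obtain ⟨n, hn⟩ := Eventually.exists hB
    exact (hw n).trans hn
  have hne : S.Nonempty := ⟨B₀, Eventually.of_forall hB₀⟩
  have hbdd : BddBelow S := ⟨0, hlow⟩
  have hL0 : 0 ≤ sInf S := le_csInf hne hlow
  have hL : sInf S = 0 := by
    refine le_antisymm (le_of_not_gt fun hpos => ?_) hL0
    have ht : 0 < (1 - β) * sInf S / 3 := by
      have := mul_pos (sub_pos.2 hβ) hpos
      positivity
    obtain ⟨B, hB, hBlt⟩ := exists_lt_of_csInf_lt hne (lt_add_of_pos_right (sInf S) ht)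
    have h1 : sInf S ≤ β * B + (1 - β) * sInf S / 3 := csInf_le hbdd (H B hB _ ht)
    nlinarith
  rw [tendsto_order]
  refine ⟨fun x hx => Eventually.of_forall fun n => hx.trans_le (hw n), fun x hx => ?_⟩
  obtain ⟨B, hB, hBlt⟩ := exists_lt_of_csInf_lt hne (hL ▸ hx)
  filter_upwards [hB] with n hn using hn.trans_lt hBlt

variable {x : ℕ → Fin r → ℂ} {δ : ℕ → ℝ}

/-- The dominant block eventually grows at least by the factor `m`, the other one by at most `b` up
to a small error, so the ratio contracts by `b / m` at each step. -/
theorem Separates.tendsto_blockNorm_div_of_dominates (h : Separates lam s a b)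
    (hδ0 : ∀ n, 0 ≤ δ n) (hδ : Tendsto δ atTop (𝓝 0))
    (hx : ∀ n k, ‖x (n + 1) k - lam k * x n k‖ ≤ δ n * ‖x n‖)
    (hle : ∀ n, blockNorm sᶜ (x n) ≤ blockNorm s (x n)) (hpos : ∀ n, 0 < blockNorm s (x n)) :
    Tendsto (fun n => blockNorm sᶜ (x n) / blockNorm s (x n)) atTop (𝓝 0) := by
  have hb := h.pos
  have hab := h.lt
  set m := (a + b) / 2 with hm
  have hm0 : 0 < m := by linarith
  refine tendsto_zero_of_contraction (β := b / m)
    (fun n => div_nonneg (blockNorm_nonneg _ _) (blockNorm_nonneg _ _))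
    ((div_lt_one hm0).2 (by linarith)) (by positivity)
    (fun n => (div_le_one (hpos n)).2 (hle n)) fun B hB η hη => ?_
  rw [← map_add_atTop_eq_nat 1, eventually_map]
  filter_upwards [hB, hδ.eventually_le_const (show 0 < a - m by linarith),
    hδ.eventually_le_const (show 0 < m * η by positivity)] with n hn h1 h2
  have hnorm : ‖x n‖ ≤ blockNorm s (x n) :=
    (norm_le_max_blockNorm s _).trans (max_le le_rfl (hle n))
  have hv : ∀ k, ‖x (n + 1) k - lam k * x n k‖ ≤ δ n * blockNorm s (x n) := fun k =>
    (hx n k).trans (mul_le_mul_of_nonneg_left hnorm (hδ0 n))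
  have hd := mul_nonneg (hδ0 n) (hpos n).le
  have h3 := h.mul_blockNorm_le hd hv
  have h4 := h.blockNorm_compl_le hd hv
  rw [div_le_iff₀ (hpos n)] at hn
  have hB0 : 0 ≤ B := by
    by_contra hneg
    have := mul_neg_of_neg_of_pos (not_le.1 hneg) (hpos n)
    linarith [blockNorm_nonneg sᶜ (x n)]
  rw [div_le_iff₀ (hpos (n + 1))]
  have h5 : m * blockNorm s (x n) ≤ blockNorm s (x (n + 1)) := by
    have := mul_le_mul_of_nonneg_right h1 (hpos n).le
    linarith
  calc blockNorm sᶜ (x (n + 1)) ≤ b * (B * blockNorm s (x n)) + m * η * blockNorm s (x n) := by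
        have := mul_le_mul_of_nonneg_right h2 (hpos n).le
        have := mul_le_mul_of_nonneg_left hn hb.le
        linarith
    _ = (b / m * B + η) * (m * blockNorm s (x n)) := by
        field_simp
    _ ≤ _ := mul_le_mul_of_nonneg_left h5 (by positivity)

/-- Here the contraction runs backwards: a bound on the ratio at time `n + 1` gives a better one at
time `n`, with factor `m / a`. The cone condition at all times supplies the initial bound. -/
theorem Separates.tendsto_blockNorm_div_of_dominated (h : Separates lam s a b)
    (hδ0 : ∀ n, 0 ≤ δ n) (hδ : Tendsto δ atTop (𝓝 0))
    (hx : ∀ n k, ‖x (n + 1) k - lam k * x n k‖ ≤ δ n * ‖x n‖)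
    (hle : ∀ n, blockNorm s (x n) ≤ blockNorm sᶜ (x n)) (hpos : ∀ n, 0 < blockNorm sᶜ (x n)) :
    Tendsto (fun n => blockNorm s (x n) / blockNorm sᶜ (x n)) atTop (𝓝 0) := by
  have hb := h.pos
  have hab := h.lt
  set m := (a + b) / 2 with hm
  have hm0 : 0 < m := by linarith
  have ha0 : 0 < a := by linarith
  refine tendsto_zero_of_contraction (β := m / a)
    (fun n => div_nonneg (blockNorm_nonneg _ _) (blockNorm_nonneg _ _))
    ((div_lt_one ha0).2 (by linarith)) (by positivity)
    (fun n => (div_le_one (hpos n)).2 (hle n)) fun B hB η hη => ?_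
  filter_upwards [(tendsto_add_atTop_nat 1).eventually hB,
    hδ.eventually_le_const (show 0 < m - b by linarith),
    hδ.eventually_le_const (show 0 < a * η by positivity)] with n hn h1 h2
  have hnorm : ‖x n‖ ≤ blockNorm sᶜ (x n) :=
    (norm_le_max_blockNorm s _).trans (max_le (hle n) le_rfl)
  have hv : ∀ k, ‖x (n + 1) k - lam k * x n k‖ ≤ δ n * blockNorm sᶜ (x n) := fun k =>
    (hx n k).trans (mul_le_mul_of_nonneg_left hnorm (hδ0 n))
  have hd := mul_nonneg (hδ0 n) (hpos n).le
  have h3 := h.mul_blockNorm_le hd hv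
  have h4 := h.blockNorm_compl_le hd hv
  rw [div_le_iff₀ (hpos (n + 1))] at hn
  have hB0 : 0 ≤ B := by
    by_contra hneg
    have := mul_neg_of_neg_of_pos (not_le.1 hneg) (hpos (n + 1))
    linarith [blockNorm_nonneg s (x (n + 1))]
  rw [div_le_iff₀ (hpos n), ← mul_le_mul_iff_right₀ ha0]
  have h5 : blockNorm sᶜ (x (n + 1)) ≤ m * blockNorm sᶜ (x n) := by
    have := mul_le_mul_of_nonneg_right h1 (hpos n).le
    linarith
  calc a * blockNorm s (x n) ≤ B * (m * blockNorm sᶜ (x n)) + a * η * blockNorm sᶜ (x n) := by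
        have := mul_le_mul_of_nonneg_right h2 (hpos n).le
        have := mul_le_mul_of_nonneg_left h5 hB0
        linarith
    _ = a * ((m / a * B + η) * blockNorm sᶜ (x n)) := by
        field_simp

/-- A trajectory that never has its coordinates before `i` dominate, and always has its
coordinates up to `i` dominate, is asymptotically concentrated at the coordinate `i`. -/
theorem tendsto_div_zero_of_cones {i : Fin r} {a₁ b₁ a₂ b₂ : ℝ}
    (h₁ : Separates lam (Set.Iio i) a₁ b₁) (h₂ : Separates lam (Set.Iic i) a₂ b₂)
    (hδ0 : ∀ n, 0 ≤ δ n) (hδ : Tendsto δ atTop (𝓝 0))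
    (hx : ∀ n k, ‖x (n + 1) k - lam k * x n k‖ ≤ δ n * ‖x n‖)
    (hle₁ : ∀ n, blockNorm (Set.Iio i) (x n) ≤ blockNorm (Set.Iio i)ᶜ (x n))
    (hle₂ : ∀ n, blockNorm (Set.Iic i)ᶜ (x n) ≤ blockNorm (Set.Iic i) (x n))
    (hpos : ∀ n, 0 < blockNorm (Set.Iic i) (x n)) :
    (∀ᶠ n in atTop, x n i ≠ 0) ∧ ∀ k ≠ i, Tendsto (fun n => x n k / x n i) atTop (𝓝 0) := by
  have hnpos : ∀ n, 0 < ‖x n‖ := fun n => (hpos n).trans_le (blockNorm_le_norm _ _)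
  have hpos₁ : ∀ n, 0 < blockNorm (Set.Iio i)ᶜ (x n) := fun n =>
    (hnpos n).trans_le ((norm_le_max_blockNorm _ _).trans (max_le (hle₁ n) le_rfl))
  have t₁ := h₁.tendsto_blockNorm_div_of_dominated hδ0 hδ hx hle₁ hpos₁
  have t₂ := h₂.tendsto_blockNorm_div_of_dominates hδ0 hδ hx hle₂ hpos
  have key : ∀ ε : ℝ, 0 < ε → ε < 1 → ∀ᶠ n in atTop, x n i ≠ 0 ∧
      ∀ k ≠ i, ‖x n k‖ ≤ ε * ‖x n i‖ := by
    intro ε hε hε1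
    filter_upwards [t₁.eventually_le_const hε, t₂.eventually_le_const hε] with n h1 h2
    rw [div_le_iff₀ (hpos₁ n)] at h1
    rw [div_le_iff₀ (hpos n)] at h2
    have hk : ∀ k ≠ i, ‖x n k‖ ≤ ε * ‖x n‖ := by
      intro k hk
      rcases lt_or_gt_of_ne hk with hlt | hlt
      · exact ((norm_le_blockNorm (x n) (show k ∈ Set.Iio i from hlt)).trans h1).trans
          (by gcongr; exact blockNorm_le_norm _ _)
      · exact ((norm_le_blockNorm (x n) (show k ∈ (Set.Iic i)ᶜ from not_le.2 hlt)).trans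
          h2).trans (by gcongr; exact blockNorm_le_norm _ _)
    -- All other coordinates are at most `ε * ‖x n‖ < ‖x n‖`, so the sup norm is attained at `i`.
    have hmax : ‖x n‖ ≤ ‖x n i‖ := by
      have : ‖x n‖ ≤ max ‖x n i‖ (ε * ‖x n‖) := by
        rw [pi_norm_le_iff_of_nonneg (le_max_of_le_left (norm_nonneg _))]
        intro k
        by_cases hki : k = i
        · subst hki
          exact le_max_left _ _
        · exact le_max_of_le_right (hk k hki)
      rcases le_max_iff.1 this with h | h
      · exact h
      · nlinarith [hnpos n]
    exact ⟨norm_pos_iff.1 ((hnpos n).trans_le hmax), fun k hki => (hk k hki).trans (by gcongr)⟩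
  refine ⟨(key (1 / 2) (by norm_num) (by norm_num)).mono fun n h => h.1, fun k hk => ?_⟩
  rw [tendsto_zero_iff_norm_tendsto_zero, tendsto_order]
  refine ⟨fun y hy => Eventually.of_forall fun n => hy.trans_le (norm_nonneg _), fun y hy => ?_⟩
  filter_upwards [key (min (y / 2) (1 / 2)) (by positivity)
    ((min_le_right _ _).trans_lt (by norm_num))] with n hn
  rw [norm_div, div_lt_iff₀ (norm_pos_iff.2 hn.1)]
  refine (hn.2 k hk).trans_lt (mul_lt_mul_of_pos_right ?_ (norm_pos_iff.2 hn.1))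
  exact (min_le_left _ _).trans_lt (by linarith)

/-- In a perturbed diagonal recursion with small perturbation some trajectory stays in the
cones attached to the coordinate `i`. -/
theorem exists_trajectory_in_cones {i : Fin r} {a₁ b₁ a₂ b₂ : ℝ}
    (h₁ : Separates lam (Set.Iio i) a₁ b₁) (h₂ : Separates lam (Set.Iic i) a₂ b₂)
    (hδ0 : ∀ n, 0 ≤ δ n) (hδ₁ : ∀ n, δ n ≤ (a₁ - b₁) / 2) (hδ₂ : ∀ n, δ n ≤ (a₂ - b₂) / 2)
    (T : ℕ → (Fin r → ℂ) →ₗ[ℂ] (Fin r → ℂ)) (hT0 : T 0 = LinearMap.id)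
    (hT : ∀ n v k, ‖T (n + 1) v k - lam k * T n v k‖ ≤ δ n * ‖T n v‖) :
    ∃ v, ∀ n, blockNorm (Set.Iio i) (T n v) ≤ blockNorm (Set.Iio i)ᶜ (T n v) ∧
      blockNorm (Set.Iic i)ᶜ (T n v) ≤ blockNorm (Set.Iic i) (T n v) ∧
      0 < blockNorm (Set.Iic i) (T n v) := by
  have hcont : ∀ n, Continuous (T n) := fun n => LinearMap.continuous_of_finiteDimensional _
  let K : ℕ → Set (Fin r → ℂ) := fun M => {v | ‖v‖ = 1 ∧ (∀ k, i < k → v k = 0) ∧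
    ∀ n ≤ M, blockNorm (Set.Iio i) (T n v) ≤ blockNorm (Set.Iio i)ᶜ (T n v)}
  have hclosed : ∀ M, IsClosed (K M) := by
    intro M
    refine (isClosed_eq continuous_norm continuous_const).inter (IsClosed.inter ?_ ?_)
    · change IsClosed {v : Fin r → ℂ | ∀ k, i < k → v k = 0}
      simp only [Set.ofPred_forall]
      exact isClosed_iInter fun k => isClosed_iInter fun _ =>
        isClosed_eq (continuous_apply k) continuous_const
    · change IsClosed {v | ∀ n ≤ M, blockNorm (Set.Iio i) (T n v) ≤ blockNorm (Set.Iio i)ᶜ (T n v)}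
      simp only [Set.ofPred_forall]
      exact isClosed_iInter fun n => isClosed_iInter fun _ => isClosed_le
        ((continuous_blockNorm _).comp (hcont n)) ((continuous_blockNorm _).comp (hcont n))
  have hcompact : IsCompact (K 0) :=
    (isCompact_sphere (0 : Fin r → ℂ) 1).of_isClosed_subset (hclosed 0)
      fun v hv => by simpa using hv.1
  have hnonempty : ∀ M, (K M).Nonempty := by
    intro M
    -- One condition per index other than `i`: coordinates before `i` vanish at time `M`, those
    -- after `i` at time `0`. These are `r - 1` conditions on `r` unknowns.
    let Φ : (Fin r → ℂ) →ₗ[ℂ] ({k : Fin r // k ≠ i} → ℂ) :=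
      LinearMap.pi fun k => if (k : Fin r) < i then LinearMap.proj (k : Fin r) ∘ₗ T M
        else LinearMap.proj (k : Fin r)
    have hker : LinearMap.ker Φ ≠ ⊥ := by
      apply LinearMap.ker_ne_bot_of_finrank_lt
      rw [Module.finrank_pi, Module.finrank_pi]
      exact Fintype.card_subtype_lt (x := i) (by simp)
    obtain ⟨v, hv, hv0⟩ := (Submodule.ne_bot_iff _).1 hker
    have hvn : (‖v‖ : ℂ) ≠ 0 := by simpa using hv0
    set w : Fin r → ℂ := (‖v‖ : ℂ)⁻¹ • v with hw
    have hwker : ∀ k : {k : Fin r // k ≠ i}, Φ w k = 0 := fun k =>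
      congrFun (LinearMap.mem_ker.1 (Submodule.smul_mem _ _ hv)) k
    have hlow : ∀ k, k < i → T M w k = 0 := fun k hk => by
      simpa [Φ, hk] using hwker ⟨k, hk.ne⟩
    have hhigh : ∀ k, i < k → w k = 0 := fun k hk => by
      simpa [Φ, hk.not_gt] using hwker ⟨k, hk.ne'⟩
    refine ⟨w, by simp [hw, norm_smul, hv0], hhigh, fun n hn => ?_⟩
    -- Once the coordinates before `i` dominate they do so forever, contradicting their vanishing at
    -- time `M`.
    by_contra hlt
    rw [not_le] at hlt
    have hstay : ∀ m, n ≤ m →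
        blockNorm (Set.Iio i)ᶜ (T m w) ≤ blockNorm (Set.Iio i) (T m w) ∧
        0 < blockNorm (Set.Iio i) (T m w) := by
      intro m hm
      induction m, hm using Nat.le_induction with
      | base => exact ⟨hlt.le, (blockNorm_nonneg _ _).trans_lt hlt⟩
      | succ m _ ih => exact h₁.cone_step (hδ0 m) (hδ₁ m) (hT m w) ih.1 ih.2
    refine (hstay M hn).2.not_ge ((blockNorm_le_iff le_rfl).2 fun k hk => ?_)
    rw [hlow k hk, norm_zero]
  obtain ⟨v, hv⟩ := IsCompact.nonempty_iInter_of_sequence_nonempty_isCompact_isClosed K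
    (fun M v hv => ⟨hv.1, hv.2.1, fun n hn => hv.2.2 n (hn.trans M.le_succ)⟩)
    hnonempty hcompact hclosed
  rw [Set.mem_iInter] at hv
  refine ⟨v, fun n => ⟨(hv n).2.2 n le_rfl, ?_⟩⟩
  induction n with
  | zero =>
    have hzero : blockNorm (Set.Iic i)ᶜ v = 0 := by
      refine le_antisymm ((blockNorm_le_iff le_rfl).2 fun k hk => ?_) (blockNorm_nonneg _ _)
      rw [(hv 0).2.1 k (not_le.1 hk), norm_zero]
    have hone : 1 ≤ max (blockNorm (Set.Iic i) v) 0 := by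
      rw [← (hv 0).1, ← hzero]
      exact norm_le_max_blockNorm _ _
    have : 1 ≤ blockNorm (Set.Iic i) v := (le_max_iff.1 hone).resolve_right (by norm_num)
    rw [hT0, LinearMap.id_apply, hzero]
    exact ⟨by linarith, by linarith⟩
  | succ n ih => exact h₂.cone_step (hδ0 n) (hδ₂ n) (hT n v) ih.1 ih.2

/-- **Perron's theorem** for perturbed diagonal recursions whose eigenvalues have distinct moduli:
every coordinate dominates along some trajectory. -/
theorem exists_trajectory_tendsto {X : Type*} [AddCommGroup X] [Module ℂ X]
    (hanti : StrictAnti fun i => ‖lam i‖) (h0 : ∀ i, lam i ≠ 0)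
    (hδ0 : ∀ n, 0 ≤ δ n) (hδ : Tendsto δ atTop (𝓝 0)) (T : ℕ → X ≃ₗ[ℂ] (Fin r → ℂ))
    (hT : ∀ n v k, ‖T (n + 1) v k - lam k * T n v k‖ ≤ δ n * ‖T n v‖) (i : Fin r) :
    ∃ v, (∀ᶠ n in atTop, T n v i ≠ 0) ∧
      ∀ k ≠ i, Tendsto (fun n => T n v k / T n v i) atTop (𝓝 0) := by
  obtain ⟨a₁, b₁, h₁⟩ := exists_separates hanti h0 (isLowerSet_Iio i)
  obtain ⟨a₂, b₂, h₂⟩ := exists_separates hanti h0 (isLowerSet_Iic i)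
  -- The perturbation is small enough only from some `N` on, so the recursion is restarted there;
  -- invertibility of `T N` carries the initial vector back to `X`.
  obtain ⟨N, hN⟩ := eventually_atTop.1 ((hδ.eventually_le_const
    (show 0 < (a₁ - b₁) / 2 by linarith [h₁.lt])).and (hδ.eventually_le_const
    (show 0 < (a₂ - b₂) / 2 by linarith [h₂.lt])))
  have hstep : ∀ n v k, ‖T (n + 1 + N) v k - lam k * T (n + N) v k‖ ≤
      δ (n + N) * ‖T (n + N) v‖ := fun n v k => by
    rw [add_right_comm]
    exact hT (n + N) v k
  obtain ⟨v, hv⟩ := exists_trajectory_in_cones (δ := fun n => δ (n + N)) h₁ h₂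
    (fun n => hδ0 _) (fun n => (hN _ (Nat.le_add_left N n)).1)
    (fun n => (hN _ (Nat.le_add_left N n)).2)
    (fun n => (T (n + N)).toLinearMap ∘ₗ (T N).symm.toLinearMap)
    (by ext; simp) (fun n v k => hstep n _ k)
  have hlim := tendsto_div_zero_of_cones (x := fun n => T (n + N) ((T N).symm v)) h₁ h₂
    (fun n => hδ0 (n + N)) ((tendsto_add_atTop_iff_nat N).2 hδ) (fun n k => hstep n _ k)
    (fun n => (hv n).1) (fun n => (hv n).2.1) (fun n => (hv n).2.2)
  refine ⟨(T N).symm v, ?_, fun k hk => ?_⟩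
  · obtain ⟨M, hM⟩ := eventually_atTop.1 hlim.1
    filter_upwards [eventually_ge_atTop (M + N)] with n hn
    have := hM (n - N) (by omega)
    rwa [Nat.sub_add_cancel (by omega)] at this
  · exact (tendsto_add_atTop_iff_nat
      (f := fun n => T n ((T N).symm v) k / T n ((T N).symm v) i) N).1 (hlim.2 k hk)

end Dynamics

/-! ### The solution space of a linear recurrence with variable coefficients -/

section SolutionSpace

variable {r : ℕ} {A : Fin (r + 1) → ℕ → ℂ}

/-- The solutions of `∑ A_i(n) u(n+i) = 0`. -/
def solutionSpace (A : Fin (r + 1) → ℕ → ℂ) : Submodule ℂ (ℕ → ℂ) where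
  carrier := {u | ∀ n, ∑ i, A i n * u (n + i) = 0}
  zero_mem' := by simp
  add_mem' {u v} hu hv n := by
    simp only [Pi.add_apply, mul_add, Finset.sum_add_distrib]
    rw [hu n, hv n, add_zero]
  smul_mem' c u hu n := by
    simp only [Pi.smul_apply, smul_eq_mul, mul_left_comm _ c, ← Finset.mul_sum]
    rw [hu n, mul_zero]

theorem eq_zero_of_initial_values (hA : ∀ n, A (Fin.last r) n = 1) {u : ℕ → ℂ}
    (hu : u ∈ solutionSpace A) (h : ∀ j < r, u j = 0) : u = 0 := by
  funext n
  induction n using Nat.strong_induction_on with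
  | _ n ih =>
    rcases lt_or_ge n r with hn | hn
    · exact h n hn
    · have h1 := hu (n - r)
      rw [Fin.sum_univ_castSucc, Finset.sum_eq_zero fun i _ => ?_] at h1
      · simpa [hA, Nat.sub_add_cancel hn] using h1
      · rw [ih _ (by have := i.2; simp only [Fin.val_castSucc]; omega), Pi.zero_apply, mul_zero]

/-- Since `A 0` never vanishes, the recurrence can also be run backwards from a window of zeros. -/
theorem eq_zero_of_window (hA : ∀ n, A (Fin.last r) n = 1) (hA0 : ∀ n, A 0 n ≠ 0) {u : ℕ → ℂ}
    (hu : u ∈ solutionSpace A) (N : ℕ) (h : ∀ j < r, u (N + j) = 0) : u = 0 := by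
  induction N with
  | zero => exact eq_zero_of_initial_values hA hu (by simpa using h)
  | succ N ih =>
    refine ih fun j hj => ?_
    rcases Nat.eq_zero_or_pos j with rfl | hpos
    · have h1 := hu N
      rw [Fin.sum_univ_succ, Finset.sum_eq_zero fun i _ => ?_] at h1
      · simpa [hA0] using h1
      · have := h i i.2
        rw [add_right_comm, add_assoc] at this
        rw [Fin.val_succ, this, mul_zero]
    · have := h (j - 1) (by omega)
      rwa [show N + 1 + (j - 1) = N + j by omega] at this

/-- The solution with leading coefficient `1` and given initial values. -/
noncomputable def solutionOfInitial (A : Fin (r + 1) → ℕ → ℂ) (v : Fin r → ℂ) : ℕ → ℂ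
  | n => if h : n < r then v ⟨n, h⟩
    else -∑ i : Fin r, A i.castSucc (n - r) * solutionOfInitial A v (n - r + i)
termination_by n => n
decreasing_by have := i.2; omega

theorem solutionOfInitial_apply (v : Fin r → ℂ) (i : Fin r) :
    solutionOfInitial A v i = v i := by
  rw [solutionOfInitial]
  simp

theorem solutionOfInitial_mem (hA : ∀ n, A (Fin.last r) n = 1) (v : Fin r → ℂ) :
    solutionOfInitial A v ∈ solutionSpace A := by
  intro n
  rw [Fin.sum_univ_castSucc, hA, one_mul, Fin.val_last,
    solutionOfInitial.eq_def A v (n + r)]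
  simp

/-- A solution is determined by its initial values, which are arbitrary. -/
noncomputable def initialValues (hA : ∀ n, A (Fin.last r) n = 1) :
    solutionSpace A ≃ₗ[ℂ] (Fin r → ℂ) :=
  LinearEquiv.ofBijective
    ((LinearMap.funLeft ℂ ℂ ((↑) : Fin r → ℕ)).comp (solutionSpace A).subtype) <| by
    constructor
    · refine (injective_iff_map_eq_zero _).2 fun u hu => Subtype.ext ?_
      exact eq_zero_of_initial_values hA u.2 fun j hj => congrFun hu ⟨j, hj⟩
    · exact fun v => ⟨⟨_, solutionOfInitial_mem hA v⟩,
        funext fun i => solutionOfInitial_apply v i⟩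

end SolutionSpace

/-! ### Diagonalising coordinates -/

section Coordinates

open Polynomial

variable {r : ℕ} {lam : Fin r → ℂ}

/-- The shift operator on sequences. -/
def shift : Module.End ℂ (ℕ → ℂ) := LinearMap.funLeft ℂ ℂ Nat.succ

theorem shift_pow_apply (j : ℕ) (u : ℕ → ℂ) (n : ℕ) : (shift ^ j) u n = u (n + j) := by
  induction j generalizing n with
  | zero => simp
  | succ j ih =>
    rw [pow_succ', Module.End.mul_apply]
    exact (ih (n + 1)).trans (by rw [add_right_comm, add_assoc])

/-- The coordinates of `(u(n), …, u(n+r-1))` in the eigenbasis of the companion matrix of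
`∏ (X - lam_k)`. -/
noncomputable def eigenCoord (lam : Fin r → ℂ) (n : ℕ) : (ℕ → ℂ) →ₗ[ℂ] (Fin r → ℂ) :=
  LinearMap.pi fun k => LinearMap.proj n ∘ₗ aeval shift (Lagrange.basis Finset.univ lam k)

theorem eigenCoord_apply (n : ℕ) (u : ℕ → ℂ) (k : Fin r) :
    eigenCoord lam n u k = aeval shift (Lagrange.basis Finset.univ lam k) u n := rfl

theorem apply_add_eq_sum_eigenCoord (hinj : Function.Injective lam) (u : ℕ → ℂ) (n : ℕ) {j : ℕ}
    (hj : j < r) : u (n + j) = ∑ k, lam k ^ j * eigenCoord lam n u k := by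
  -- A monomial of degree below `r` equals its Lagrange interpolant at the `r` eigenvalues.
  have h1 : (X ^ j : ℂ[X]) = ∑ k, C (lam k ^ j) * Lagrange.basis Finset.univ lam k := by
    rw [← Lagrange.interpolate_apply (s := Finset.univ) (v := lam) (r := fun k => lam k ^ j)]
    refine Lagrange.eq_interpolate_of_eval_eq _ hinj.injOn ?_ fun k _ => by simp
    rw [degree_X_pow, Finset.card_univ, Fintype.card_fin]
    exact_mod_cast hj
  have h2 := congrArg (fun p : ℂ[X] => aeval shift p u n) h1
  rw [map_pow, aeval_X, shift_pow_apply] at h2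
  rw [h2, map_sum, LinearMap.sum_apply, Finset.sum_apply]
  refine Finset.sum_congr rfl fun k _ => ?_
  rw [map_mul, aeval_C, Module.End.mul_apply, Module.algebraMap_end_apply, Pi.smul_apply,
    smul_eq_mul, eigenCoord_apply]

/-- This is why the Lagrange basis diagonalises: `shift - lam k` applied to the `k`-th coordinate
gives a multiple of the characteristic polynomial in `shift`, which kills solutions of the limiting
recurrence. -/
theorem X_sub_C_mul_lagrangeBasis (k : Fin r) :
    (X - C (lam k)) * Lagrange.basis Finset.univ lam k =
      C (Lagrange.nodalWeight Finset.univ lam k) * ∏ i, (X - C (lam i)) := by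
  rw [Lagrange.basis_eq_prod_sub_inv_mul_nodal_div (Finset.mem_univ k),
    ← Lagrange.nodal_erase_eq_nodal_div (Finset.mem_univ k), ← Lagrange.nodal_eq,
    Lagrange.nodal_eq_mul_nodal_erase (Finset.mem_univ k)]
  ring

theorem eigenCoord_succ {α : Fin (r + 1) → ℂ}
    (hα : ∑ i, C (α i) * X ^ (i : ℕ) = ∏ i, (X - C (lam i))) (u : ℕ → ℂ) (n : ℕ) (k : Fin r) :
    eigenCoord lam (n + 1) u k - lam k * eigenCoord lam n u k =
      Lagrange.nodalWeight Finset.univ lam k * ∑ i, α i * u (n + i) := by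
  have h1 := congrArg (fun p : ℂ[X] => aeval shift p u n) (X_sub_C_mul_lagrangeBasis (lam := lam) k)
  simp only [← hα, map_mul, map_sub, aeval_X, aeval_C, map_sum, map_pow, Module.End.mul_apply,
    LinearMap.sub_apply, Module.algebraMap_end_apply, LinearMap.sum_apply, Pi.sub_apply,
    Pi.smul_apply, Finset.sum_apply, smul_eq_mul, shift_pow_apply, ← Finset.mul_sum] at h1
  exact h1

variable {A : Fin (r + 1) → ℕ → ℂ}

theorem norm_eigenCoord_succ_sub_le (hinj : Function.Injective lam) {α : Fin (r + 1) → ℂ}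
    (hα : ∑ i, C (α i) * X ^ (i : ℕ) = ∏ i, (X - C (lam i)))
    (hA : ∀ n, A (Fin.last r) n = α (Fin.last r)) {u : ℕ → ℂ} (hu : u ∈ solutionSpace A)
    (n : ℕ) (k : Fin r) :
    ‖eigenCoord lam (n + 1) u k - lam k * eigenCoord lam n u k‖ ≤
      (∑ i, ‖Lagrange.nodalWeight Finset.univ lam i‖) *
        (∑ j : Fin r, ‖α j.castSucc - A j.castSucc n‖ * ∑ i, ‖lam i‖ ^ (j : ℕ)) *
          ‖eigenCoord lam n u‖ := by
  -- Subtracting the actual recurrence leaves only coefficient differences. The leading one is zero,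
  -- so only the window `u n, …, u (n + r - 1)`, controlled by `eigenCoord`, remains.
  have h1 : ∑ i, α i * u (n + i) =
      ∑ j : Fin r, (α j.castSucc - A j.castSucc n) * u (n + j) := by
    have h2 : ∑ i, α i * u (n + i) = ∑ i, (α i - A i n) * u (n + i) := by
      simp only [sub_mul, Finset.sum_sub_distrib]
      rw [hu n, sub_zero]
    rw [h2, Fin.sum_univ_castSucc, hA, sub_self, zero_mul, add_zero]
    rfl
  rw [eigenCoord_succ hα, h1, norm_mul, mul_assoc]
  refine mul_le_mul (Finset.single_le_sum
    (f := fun i => ‖Lagrange.nodalWeight Finset.univ lam i‖) (fun i _ => norm_nonneg _)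
    (Finset.mem_univ k)) ?_ (norm_nonneg _) (Finset.sum_nonneg fun i _ => norm_nonneg _)
  rw [Finset.sum_mul]
  refine norm_sum_le_of_le _ fun j _ => ?_
  rw [norm_mul, mul_assoc]
  refine mul_le_mul_of_nonneg_left ?_ (norm_nonneg _)
  rw [apply_add_eq_sum_eigenCoord hinj u n j.2, Finset.sum_mul]
  refine norm_sum_le_of_le _ fun i _ => ?_
  rw [norm_mul, norm_pow]
  exact mul_le_mul_of_nonneg_left (norm_le_pi_norm _ i) (by positivity)

/-- **Perron's theorem** for recurrences whose eigenvalues have distinct moduli: every eigenvalue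
is the limit of the successive quotients of some solution. -/
theorem exists_solution_tendsto_ratio (hanti : StrictAnti fun i => ‖lam i‖)
    (h0 : ∀ i, lam i ≠ 0) {α : Fin (r + 1) → ℂ}
    (hα : ∑ i, C (α i) * X ^ (i : ℕ) = ∏ i, (X - C (lam i)))
    (hAα : ∀ i, Tendsto (A i) atTop (𝓝 (α i)))
    (hA : ∀ n, A (Fin.last r) n = 1) (hA0 : ∀ n, A 0 n ≠ 0) (i : Fin r) :
    ∃ u ∈ solutionSpace A, Tendsto (fun n => u (n + 1) / u n) atTop (𝓝 (lam i)) := by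
  have hinj : Function.Injective lam := fun k l h => hanti.injective (congrArg norm h)
  have hlast : α (Fin.last r) = 1 :=
    tendsto_nhds_unique (hAα _) (tendsto_const_nhds.congr fun n => (hA n).symm)
  have hTinj : ∀ n, Function.Injective ((eigenCoord lam n).comp (solutionSpace A).subtype) := by
    refine fun n => (injective_iff_map_eq_zero _).2 fun u hu => Subtype.ext ?_
    refine eq_zero_of_window hA hA0 u.2 n fun j hj => ?_
    refine (apply_add_eq_sum_eigenCoord hinj u n hj).trans ?_
    exact Finset.sum_eq_zero fun k _ => by
      rw [show eigenCoord lam n u k = 0 from congrFun hu k, mul_zero]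
  have : FiniteDimensional ℂ (solutionSpace A) :=
    LinearEquiv.finiteDimensional (initialValues hA).symm
  let T : ℕ → solutionSpace A ≃ₗ[ℂ] (Fin r → ℂ) := fun n =>
    LinearEquiv.ofInjectiveOfFinrankEq _ (hTinj n) (initialValues hA).finrank_eq
  let δ : ℕ → ℝ := fun n => (∑ i, ‖Lagrange.nodalWeight Finset.univ lam i‖) *
    (∑ j : Fin r, ‖α j.castSucc - A j.castSucc n‖ * ∑ i, ‖lam i‖ ^ (j : ℕ))
  have hδ0 : ∀ n, 0 ≤ δ n := fun n => by positivity
  have hδ : Tendsto δ atTop (𝓝 0) := by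
    have h1 : ∀ j : Fin r, Tendsto (fun n => ‖α j.castSucc - A j.castSucc n‖ *
        ∑ i, ‖lam i‖ ^ (j : ℕ)) atTop (𝓝 0) := fun j => by
      have := ((hAα j.castSucc).const_sub (α j.castSucc)).norm.mul_const
        (∑ i, ‖lam i‖ ^ (j : ℕ))
      simpa using this
    simpa using (tendsto_finsetSum Finset.univ fun j _ => h1 j).const_mul
      (∑ i, ‖Lagrange.nodalWeight Finset.univ lam i‖)
  obtain ⟨u, hne, hlim⟩ := exists_trajectory_tendsto hanti h0 hδ0 hδ T
    (fun n u k => norm_eigenCoord_succ_sub_le hinj hα (fun n => (hA n).trans hlast.symm) u.2 n k) i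
  refine ⟨u, u.2, ?_⟩
  have hunit : Tendsto (fun n => (T n u i)⁻¹ • T n u) atTop (𝓝 (Pi.single i 1)) := by
    refine tendsto_pi_nhds.2 fun k => ?_
    by_cases hk : k = i
    · subst hk
      rw [Pi.single_eq_same]
      refine tendsto_const_nhds.congr' ?_
      filter_upwards [hne] with n hn
      rw [Pi.smul_apply, smul_eq_mul, inv_mul_cancel₀ hn]
    · rw [Pi.single_eq_of_ne hk]
      exact (hlim k hk).congr fun n => by
        rw [Pi.smul_apply, smul_eq_mul, div_eq_inv_mul]
  -- `u n` is the sum of its eigencoordinates, and only the `i`-th matters asymptotically.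
  have hu : Tendsto (fun n => (u : ℕ → ℂ) n / T n u i) atTop (𝓝 1) := by
    have h1 := tendsto_finsetSum Finset.univ fun k _ => tendsto_pi_nhds.1 hunit k
    rw [Finset.sum_pi_single', if_pos (Finset.mem_univ i)] at h1
    refine h1.congr fun n => ?_
    have h2 := apply_add_eq_sum_eigenCoord hinj (u : ℕ → ℂ) n i.pos
    simp only [add_zero, pow_zero, one_mul] at h2
    rw [h2, div_eq_inv_mul, Finset.mul_sum]
    rfl
  have hT : Tendsto (fun n => T (n + 1) u i / T n u i) atTop (𝓝 (lam i)) := by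
    rw [tendsto_iff_norm_sub_tendsto_zero]
    have h1 := hδ.mul hunit.norm
    rw [zero_mul] at h1
    refine squeeze_zero' (Eventually.of_forall fun n => norm_nonneg _) ?_ h1
    filter_upwards [hne] with n hn
    have h2 := norm_eigenCoord_succ_sub_le hinj hα (fun n => (hA n).trans hlast.symm) u.2 n i
    rw [div_sub' hn, norm_div, norm_smul, norm_inv, mul_comm (T n u i)]
    refine (div_le_div_of_nonneg_right h2 (norm_nonneg _)).trans_eq ?_
    rw [div_eq_inv_mul]
    exact mul_left_comm _ _ _
  have h1 := ((hu.comp (tendsto_add_atTop_nat 1)).div hu one_ne_zero).mul hT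
  rw [div_one, one_mul] at h1
  refine h1.congr' ?_
  filter_upwards [hne, (tendsto_add_atTop_nat 1).eventually hne, hu.eventually_ne one_ne_zero]
    with n hn hn1 hn2
  have hn3 : u.1 n ≠ 0 := fun h => hn2 (by rw [h, zero_div])
  simp only [Function.comp, Pi.div_apply]
  field_simp

end Coordinates

/-! ### Asymptotic systems -/

section AsymptoticSystem

variable {r : ℕ} {a : Fin (r + 1) → RatFunc ℚ} {lam : Fin r → ℂ} {f : Fin r → ℕ → ℂ}

/-- The coefficients of the recurrence as complex sequences. -/
noncomputable def complexCoeff (a : Fin (r + 1) → RatFunc ℚ) (i : Fin (r + 1)) (n : ℕ) : ℂ :=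
  ((coeffAt (a i) n : ℚ) : ℂ)

theorem PoincarePerron.complexCoeff_last (hL : PoincarePerron a lam) (n : ℕ) :
    complexCoeff a (Fin.last r) n = 1 := by
  rw [complexCoeff, hL.monic, coeffAt, RatFunc.eval_one, Rat.cast_one]

theorem IsAsymptoticSystem.tendsto_ratio (hf : IsAsymptoticSystem a lam f)
    (h0 : ∀ i, lam i ≠ 0) (i : Fin r) :
    Tendsto (fun n => lam i ^ (n + 1) * f i (n + 1) / (lam i ^ n * f i n)) atTop
      (𝓝 (lam i)) := by
  have h1 := (hf.ratio i).const_mul (lam i)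
  rw [mul_one] at h1
  refine h1.congr fun n => ?_
  rw [mul_div_mul_comm, pow_succ, mul_div_cancel_left₀ _ (pow_ne_zero n (h0 i))]

theorem isExpansion_iff {c : Fin r → ℂ} {u : ℕ → ℂ} :
    IsExpansion lam f c u ↔ ∀ n, u n = ∑ i, c i * (lam i ^ n * f i n) := by
  simp only [IsExpansion, mul_assoc]

theorem exists_isAsymptoticSystem (hL : PoincarePerron a lam) (ha : ∀ n, coeffAt (a 0) n ≠ 0) :
    ∃ f, IsAsymptoticSystem a lam f := by
  obtain ⟨α, hα, hchar⟩ := hL.charpoly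
  have hlim : ∀ i, Tendsto (complexCoeff a i) atTop (𝓝 (α i : ℂ)) := fun i =>
    ((Complex.continuous_ofReal.tendsto _).comp (hα i)).congr fun n =>
      Complex.ofReal_ratCast _
  choose u hu hratio using exists_solution_tendsto_ratio hL.strictAnti hL.ne_zero hchar hlim
    hL.complexCoeff_last fun n => Rat.cast_ne_zero.2 (ha n)
  have hcancel : ∀ i n, lam i ^ n * (u i n / lam i ^ n) = u i n := fun i n =>
    mul_div_cancel₀ _ (pow_ne_zero n (hL.ne_zero i))
  refine ⟨fun i n => u i n / lam i ^ n, fun i n => ?_, fun i => ?_⟩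
  · simp only [hcancel]
    exact hu i n
  · have h1 := (hratio i).div_const (lam i)
    rw [div_self (hL.ne_zero i)] at h1
    refine h1.congr fun n => ?_
    have := hL.ne_zero i
    rw [div_div_div_comm, pow_succ, mul_div_cancel_left₀ _ (pow_ne_zero n this)]

/-- The map from constants to solutions is injective by distinct growth, and initial values identify
its target with `Fin r → ℂ`; equal dimensions make it bijective. -/
theorem IsAsymptoticSystem.existsUnique_isExpansion (hL : PoincarePerron a lam)
    (hf : IsAsymptoticSystem a lam f) {u : ℕ → ℂ} (hu : IsSolution a u) :
    ∃! c, IsExpansion lam f c u := by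
  have hratio := hf.tendsto_ratio hL.ne_zero
  let Φ : (Fin r → ℂ) →ₗ[ℂ] solutionSpace (complexCoeff a) :=
    Fintype.linearCombination ℂ fun i =>
      (⟨fun n => lam i ^ n * f i n, hf.solution i⟩ : solutionSpace (complexCoeff a))
  have hΦ : ∀ c n, (Φ c : ℕ → ℂ) n = ∑ i, c i * (lam i ^ n * f i n) := fun c n => by
    simp [Φ, Fintype.linearCombination_apply]
  have hinj : Function.Injective Φ := by
    refine (injective_iff_map_eq_zero _).2 fun c hc => ?_
    refine eq_zero_of_combination_eq_zero (g := fun i n => lam i ^ n * f i n)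
      hL.strictAnti hL.ne_zero hratio c fun n => ?_
    rw [← hΦ, hc]
    rfl
  let e := initialValues hL.complexCoeff_last
  have hsurj : Function.Surjective Φ := by
    have h1 : Function.Surjective (e.toLinearMap ∘ₗ Φ) :=
      LinearMap.injective_iff_surjective.1 (e.injective.comp hinj)
    exact fun v => (h1 (e v)).imp fun c hc => e.injective hc
  have hiff : ∀ c, IsExpansion lam f c u ↔ Φ c = ⟨u, hu⟩ := fun c => by
    rw [isExpansion_iff, Subtype.ext_iff, funext_iff]
    exact forall_congr' fun n => by rw [hΦ, eq_comm]
  simp only [hiff]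
  exact ⟨_, (hsurj ⟨u, hu⟩).choose_spec, fun c hc =>
    hinj (hc.trans (hsurj ⟨u, hu⟩).choose_spec.symm)⟩

end AsymptoticSystem

theorem mainTheorem5 {r : ℕ} (a : Fin (r + 1) → RatFunc ℚ) (lam : Fin r → ℂ)
    (hL : PoincarePerron a lam) :
    -- existence of the decomposition, when the trailing coefficient never vanishes
    ((∀ n : ℕ, coeffAt (a 0) n ≠ 0) →
      (∃ f : Fin r → ℕ → ℂ, IsAsymptoticSystem a lam f) ∧
      ∀ f : Fin r → ℕ → ℂ, IsAsymptoticSystem a lam f →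
        ∀ u : ℕ → ℂ, IsSolution a u → ∃! c : Fin r → ℂ, IsExpansion lam f c u) ∧
    -- the ratio of two solutions
    ∀ f : Fin r → ℕ → ℂ, IsAsymptoticSystem a lam f →
      ∀ u₁ u₂ : ℕ → ℝ, IsSolution a u₁ → IsSolution a u₂ → LinearIndependent ℝ ![u₁, u₂] →
      ∀ c c' : Fin r → ℂ, IsExpansion lam f c (fun n => (u₁ n : ℂ)) →
        IsExpansion lam f c' (fun n => (u₂ n : ℂ)) →
      ((∃ l : ℝ, l ≠ 0 ∧ HasAperyLimit u₁ u₂ l) ↔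
        ∃ j : Fin r, IsLeast {i | c i ≠ 0} j ∧ IsLeast {i | c' i ≠ 0} j) ∧
      ∀ j : Fin r, IsLeast {i | c i ≠ 0} j → IsLeast {i | c' i ≠ 0} j →
        ∃ l : ℝ, (l : ℂ) = c j / c' j ∧ HasAperyLimit u₁ u₂ l ∧
          ∃ k : Fin r, IsLeast {i | c' j * c i - c j * c' i ≠ 0} k ∧
            HasConvergenceRate (fun n => u₁ n / u₂ n) l (Real.log ‖lam k / lam j‖) := by
  refine ⟨fun ha => ⟨exists_isAsymptoticSystem hL ha,
    fun f hf u hu => hf.existsUnique_isExpansion hL hu⟩, ?_⟩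
  intro f hf u₁ u₂ _ _ hli c c' he₁ he₂
  rw [isExpansion_iff] at he₁ he₂
  have hanti := hL.strictAnti
  have h0 := hL.ne_zero
  have hg := hf.tendsto_ratio h0
  have hu₁ : u₁ ≠ 0 := hli.ne_zero 0
  have hu₂ : u₂ ≠ 0 := hli.ne_zero 1
  have hc : c ≠ 0 := by
    rintro rfl
    exact hu₁ (funext fun n => by simpa using he₁ n)
  have hc' : c' ≠ 0 := by
    rintro rfl
    exact hu₂ (funext fun n => by simpa using he₂ n)
  refine ⟨⟨fun ⟨l, hl0, hl⟩ => exists_isLeast_of_hasAperyLimit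
    (g := fun i n => lam i ^ n * f i n) hanti h0 hg he₁ he₂ hc hc' hl0 hl, ?_⟩, ?_⟩
  · rintro ⟨j, hj, hj'⟩
    obtain ⟨l, hl, hlim⟩ := hasAperyLimit_of_isLeast
      (g := fun i n => lam i ^ n * f i n) hanti h0 hg he₁ he₂ hj hj'
    refine ⟨l, ?_, hlim⟩
    rintro rfl
    exact div_ne_zero hj.1 hj'.1 (by simpa using hl.symm)
  · intro j hj hj'
    obtain ⟨l, hl, hlim⟩ := hasAperyLimit_of_isLeast
      (g := fun i n => lam i ^ n * f i n) hanti h0 hg he₁ he₂ hj hj'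
    -- Otherwise `c = l • c'` with `l` real, so `u₁ = l • u₂`, against independence over `ℝ`.
    have hd : (fun i => c' j * c i - c j * c' i) ≠ 0 := by
      intro h
      have hcl : ∀ i, c i = l * c' i := fun i => by
        have h1 : c' j * c i = c j * c' i := sub_eq_zero.1 (congrFun h i)
        rw [hl, div_mul_eq_mul_div, ← h1, mul_div_cancel_left₀ _ hj'.1]
      have hul : u₁ = l • u₂ := by
        funext n
        have h2 : (u₁ n : ℂ) = l * u₂ n := by
          rw [he₁, he₂, Finset.mul_sum]
          exact Finset.sum_congr rfl fun i _ => by rw [hcl, mul_assoc]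
        exact_mod_cast h2
      have := (LinearIndependent.pair_iff.1 hli 1 (-l) (by rw [hul]; module)).1
      exact one_ne_zero this
    obtain ⟨k, hk⟩ := exists_isLeast_ne_zero hd
    exact ⟨l, hl, hlim, k, hk, hasConvergenceRate_of_isLeast
      (g := fun i n => lam i ^ n * f i n) hanti h0 hg he₁ he₂ hj' hk hl hlim⟩
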